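/- Let $\Lambda = \{2n_1\omega_1 + 2n_2\omega_2 : n_1, n_2 \in \mathbb{Z}\} \subset \mathbb{C}$ be any lattice, where $\omega_1, \omega_2 \in \mathbb{C}$ are linearly independent over $\mathbb{R}$, and let $\omega_3 = -\omega_1 - \omega_2$. Let $$\wp(z) = z^{-2} + \sum_{0 \neq \lambda \in \Lambda} \{(z-\lambda)^{-2} - \lambda^{-2}\}, \qquad g_3 = 140 \sum_{0 \neq \lambda \in \Lambda} \lambda^{-6}$$ be the associated Weierstrass function and invariant, and let $e_p = \wp(\omega_p)$ for $p = 1, 2, 3$ be the midpoint constants. A meromorphic square root of a meromorphic function $f$ on $\mathbb{C}$ is a meromorphic function $J$ on $\mathbb{C}$ with $J^2 = f$ (an identity of meromorphic functions). The primitive function $J_p$ is the meromorphic square root of $\wp - e_p$ that satisfies $z J_p(z) \to 1$ as $z \to 0$. (i) If $g_3 = 0$, then exactly one of the midpoint constants $e_1, e_2, e_3$ vanishes. If $e_p$ is the one that vanishes, then $\omega_p$ is a double zero of $\wp$, the primitive function $J_p$ exists and is unique, and $J_p$ is a meromorphic square root of $\wp$ on $\mathbb{C}$. (ii) If $g_3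 \neq 0$, then none of the midpoint constants vanishes, all zeros of $\wp$ are simple, and $\wp$ has no meromorphic square root on $\mathbb{C}$. In particular, $\wp$ has a meromorphic square root on $\mathbb{C}$ if and only if $g_3 = 0$. -/

import Mathlib

open Filter Topology

namespace PeriodPair

/-- The half periods `ω₁, ω₂, ω₃` with `ω₁ + ω₂ + ω₃ = 0`, the lattice being generated by
`2 * ω₁` and `2 * ω₂`. (The fields `L.ω₁`, `L.ω₂` of a `PeriodPair` are full periods.) -/
noncomputable def halfPeriod (L : PeriodPair) : Fin 3 → ℂ :=
  ![L.ω₁ / 2, L.ω₂ / 2, -(L.ω₁ / 2 + L.ω₂ / 2)]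

/-- The midpoint constants `e₁, e₂, e₃`: the values of `℘` at the half periods. -/
noncomputable def midpointConstant (L : PeriodPair) (p : Fin 3) : ℂ :=
  L.weierstrassP (L.halfPeriod p)

end PeriodPair

/-- `J` is a (global) meromorphic square root of the meromorphic function `f` on the plane:
`J` is meromorphic on all of `ℂ` and `J ^ 2 = f` as meromorphic functions, that is, pointwise
off a closed discrete set (the values of meromorphic functions at poles are conventional). -/
def IsMeromorphicSqrt (J f : ℂ → ℂ) : Prop :=
  Meromorphic J ∧ (fun z => J z ^ 2) =ᶠ[codiscrete ℂ] f

/-- `J` is the primitive function `J_p` of the lattice: the meromorphic square root of `℘ - e_p`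
with `z * J z → 1` as `z → 0`. Being in normal form fixes the values of `J` everywhere (the
continuous ones off the poles, and `0` at the poles), so that a meromorphic function is the same
as an honest function. -/
def PeriodPair.IsPrimitiveFunction (L : PeriodPair) (p : Fin 3) (J : ℂ → ℂ) : Prop :=
  MeromorphicNFOn J Set.univ ∧
    IsMeromorphicSqrt J (fun z => L.weierstrassP z - L.midpointConstant p) ∧
    Tendsto (fun z => z * J z) (𝓝[≠] 0) (𝓝 1)

namespace PeriodPair

/-! ### Periodicity, pole orders and Liouville's theorem. -/

variable (L : PeriodPair)

/-! The engine is Liouville's theorem for elliptic functions. For a half period `h`, the product `(℘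
z - ℘ h) * (℘ (z + h) - ℘ h)` has no poles, because double zeros meet double poles, so it is a
nonzero constant. Off the lattice, `℘` therefore takes the value `℘ h` only at points congruent to
`h`, with multiplicity exactly two. The midpoint constants are then three distinct roots of `4x³ -
g₂x - g₃`, with product `g₃ / 4`: exactly one vanishes if `g₃ = 0`, and none otherwise.

If `g₃ ≠ 0`, the differential equation gives `℘'² = -g₃` at a zero, so zeros are simple. A zero
exists by Liouville, and its odd order rules out a square root.

For existence of `J_p`, choose periods with `ω₁ / 2 = ω_p` and let `M` be the lattice with `ω₂`
doubled. The function `J = -℘_M' / (2 (℘_M - ℘_M ω₂))` changes sign under translation by `ω₂`, so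
`J²` has the original periods. Then `J² - ℘` has no poles and is constant
(`isMeromorphicSqrt_halfLogDeriv_doubleSnd`); evaluating at `ω₁ / 2`, where `J = 0`, gives `-e_p`.
-/

theorem weierstrassP_add_of_mem (z : ℂ) {l : ℂ} (hl : l ∈ L.lattice) :
    ℘[L] (z + l) = ℘[L] z :=
  L.weierstrassP_add_coe z ⟨l, hl⟩

theorem derivWeierstrassP_add_of_mem (z : ℂ) {l : ℂ} (hl : l ∈ L.lattice) :
    ℘'[L] (z + l) = ℘'[L] z :=
  L.derivWeierstrassP_add_coe z ⟨l, hl⟩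

theorem hasDerivAt_weierstrassP {z : ℂ} (hz : z ∉ L.lattice) :
    HasDerivAt ℘[L] (℘'[L] z) z := by
  have h := (L.analyticOnNhd_weierstrassP z hz).differentiableAt.hasDerivAt
  rwa [L.deriv_weierstrassP] at h

/-- Liouville's theorem: an elliptic function without poles is constant. -/
theorem exists_eventuallyEq_const_of_periodic {F : ℂ → ℂ} (hF : Meromorphic F)
    (hper : ∀ z, ∀ l ∈ L.lattice, F (z + l) = F z) (ho : ∀ z, 0 ≤ meromorphicOrderAt F z) :
    ∃ c, ∀ z, F =ᶠ[𝓝[≠] z] fun _ ↦ c := by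
  have hFU : MeromorphicOn F Set.univ := fun z _ ↦ hF z
  set g := toMeromorphicNFOn F Set.univ
  have hgF (z : ℂ) : g =ᶠ[𝓝[≠] z] F := hFU.toMeromorphicNFOn_eq_self_on_nhdsNE (Set.mem_univ z)
  have hga (z : ℂ) : AnalyticAt ℂ g z := by
    rw [← (meromorphicNFOn_toMeromorphicNFOn F Set.univ
      (Set.mem_univ z)).meromorphicOrderAt_nonneg_iff_analyticAt, meromorphicOrderAt_congr (hgF z)]
    exact ho z
  have hgd : Differentiable ℂ g := fun z ↦ (hga z).differentiableAt
  have hgper (z l : ℂ) (hl : l ∈ L.lattice) : g (z + l) = g z := by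
    -- Normalizing may change values of `F`, so periodicity of `g` is recovered by continuity from
    -- punctured neighbourhoods.
    have h1 : Tendsto (· + l) (𝓝[≠] z) (𝓝[≠] (z + l)) := by
      refine tendsto_nhdsWithin_iff.mpr ⟨?_, ?_⟩
      · exact (Continuous.tendsto (by fun_prop) z).mono_left nhdsWithin_le_nhds
      · filter_upwards [self_mem_nhdsWithin] with w hw
        simpa using hw
    have h2 : (fun w ↦ g (w + l)) =ᶠ[𝓝[≠] z] g := by
      filter_upwards [h1.eventually (hgF (z + l)), hgF z] with w hw hw'
      rw [hw, hw', hper w l hl]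
    refine tendsto_nhds_unique_of_eventuallyEq (l := 𝓝[≠] z) ?_ ?_ h2
    · exact (Continuous.tendsto (by have := hgd.continuous; fun_prop) z).mono_left
        nhdsWithin_le_nhds
    · exact (hgd.continuous.tendsto z).mono_left nhdsWithin_le_nhds
  refine ⟨g 0, fun z ↦ ?_⟩
  filter_upwards [hgF z] with w hw
  rw [← hw]
  exact hgd.apply_eq_apply_of_bounded (IsZLattice.isCompact_range_of_periodic L.lattice g
    hgd.continuous hgper).isBounded w 0

theorem eq_of_eventuallyEq_const {F : ℂ → ℂ} {z c : ℂ} (hF : F =ᶠ[𝓝[≠] z] fun _ ↦ c)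
    (hc : ContinuousAt F z) : F z = c :=
  tendsto_nhds_unique_of_eventuallyEq (hc.tendsto.mono_left nhdsWithin_le_nhds)
    tendsto_const_nhds hF

theorem meromorphicOrderAt_weierstrassP_sub_const (a : ℂ) {l : ℂ} (hl : l ∈ L.lattice) :
    meromorphicOrderAt (fun z ↦ ℘[L] z - a) l = -2 := by
  rw [← L.order_weierstrassP l hl]
  simp only [sub_eq_add_neg]
  refine meromorphicOrderAt_add_eq_left_of_lt (f₂ := fun _ ↦ -a) (by fun_prop) ?_
  rw [L.order_weierstrassP l hl]
  exact lt_of_lt_of_le (by decide) (analyticAt_const (v := -a)).meromorphicOrderAt_nonneg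

theorem meromorphicOrderAt_weierstrassP_sub_const_ne_top (a z : ℂ) :
    meromorphicOrderAt (fun z ↦ ℘[L] z - a) z ≠ ⊤ := by
  refine MeromorphicOn.meromorphicOrderAt_ne_top_of_isPreconnected (U := Set.univ) (x := 0)
    (fun z _ ↦ ?_) isPreconnected_univ (Set.mem_univ _) (Set.mem_univ _) ?_
  · have := L.meromorphic_weierstrassP z
    fun_prop
  · rw [L.meromorphicOrderAt_weierstrassP_sub_const a L.lattice.zero_mem]
    decide

/-! ### Values of `℘` at half periods. -/

section HalfPeriod

variable {L} {h : ℂ}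

/-- `℘'` is odd and periodic. This also covers lattice points, where the value is conventional. -/
theorem derivWeierstrassP_eq_zero_of_two_mul_mem (h2 : 2 * h ∈ L.lattice) : ℘'[L] h = 0 := by
  have h1 := L.derivWeierstrassP_add_of_mem (-h) h2
  rw [show -h + 2 * h = h by ring, L.derivWeierstrassP_neg] at h1
  exact CharZero.eq_neg_self_iff.mp h1

theorem two_le_meromorphicOrderAt_sub (hh : h ∉ L.lattice) (h2 : 2 * h ∈ L.lattice) :
    2 ≤ meromorphicOrderAt (fun z ↦ ℘[L] z - ℘[L] h) h := by
  have ha : AnalyticAt ℂ (fun z ↦ ℘[L] z - ℘[L] h) h :=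
    (L.analyticOnNhd_weierstrassP h hh).sub analyticAt_const
  rw [ha.meromorphicOrderAt_eq]
  have h3 : (2 : ℕ) ≤ analyticOrderAt (fun z ↦ ℘[L] z - ℘[L] h) h := by
    rw [natCast_le_analyticOrderAt_iff_iteratedDeriv_eq_zero ha]
    intro i hi
    interval_cases i
    · simp
    · simp [derivWeierstrassP_eq_zero_of_two_mul_mem h2]
  generalize analyticOrderAt (fun z ↦ ℘[L] z - ℘[L] h) h = n at h3
  cases n with
  | top => simp
  | coe n =>
    have h4 : (2 : ℤ) ≤ n := by exact_mod_cast h3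
    exact WithTop.coe_le_coe.mpr h4

theorem meromorphicOrderAt_comp_add_const (f : ℂ → ℂ) (h z : ℂ) :
    meromorphicOrderAt (fun z ↦ f (z + h)) z = meromorphicOrderAt f (z + h) :=
  meromorphicOrderAt_comp_add_const_eq_meromorphicOrderAt

/-- Translation by a half period `h` turns `℘ - ℘ h` into a multiple of its inverse. -/
theorem exists_mul_translate_eventuallyEq (hh : h ∉ L.lattice) (h2 : 2 * h ∈ L.lattice) :
    ∃ c, c ≠ 0 ∧ ∀ z, (fun z ↦ (℘[L] z - ℘[L] h) * (℘[L] (z + h) - ℘[L] h))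
      =ᶠ[𝓝[≠] z] fun _ ↦ c := by
  set Q : ℂ → ℂ := fun z ↦ ℘[L] z - ℘[L] h with hQ
  have hQm : Meromorphic Q := fun z ↦ by have := L.meromorphic_weierstrassP z; fun_prop
  have hTm : Meromorphic fun z ↦ Q (z + h) := fun z ↦
    (hQm (z + h)).comp_analyticAt (f := Q) (g := (· + h)) (by fun_prop)
  have hQper (z l : ℂ) (hl : l ∈ L.lattice) : Q (z + l) = Q z := by
    simp [hQ, L.weierstrassP_add_of_mem z hl]
  have hord (z : ℂ) : meromorphicOrderAt (fun z ↦ Q z * Q (z + h)) z =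
      meromorphicOrderAt Q z + meromorphicOrderAt Q (z + h) := by
    rw [← meromorphicOrderAt_comp_add_const]
    exact meromorphicOrderAt_mul (hQm z) (hTm z)
  have hordper (z l : ℂ) (hl : l ∈ L.lattice) :
      meromorphicOrderAt Q (z + l) = meromorphicOrderAt Q z := by
    rw [← meromorphicOrderAt_comp_add_const]
    exact congrArg (meromorphicOrderAt · z) (funext fun w ↦ hQper w l hl)
  have hnn (z : ℂ) (hz : z ∉ L.lattice) : 0 ≤ meromorphicOrderAt Q z :=
    ((L.analyticOnNhd_weierstrassP z hz).sub analyticAt_const).meromorphicOrderAt_nonneg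
  have hz0 : ∀ a b : WithTop ℤ, a = -2 → 2 ≤ b → 0 ≤ a + b := by
    rintro a b rfl hb
    calc (0 : WithTop ℤ) = -2 + 2 := rfl
      _ ≤ -2 + b := by gcongr
  obtain ⟨c, hc⟩ := L.exists_eventuallyEq_const_of_periodic (F := fun z ↦ Q z * Q (z + h))
    (fun z ↦ (hQm z).mul (hTm z))
    (fun z l hl ↦ by rw [hQper z l hl, add_right_comm, hQper _ l hl]) (fun z ↦ by
      rw [hord]
      by_cases hz : z ∈ L.lattice
      · refine hz0 _ _ (L.meromorphicOrderAt_weierstrassP_sub_const _ hz) ?_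
        rw [add_comm, hordper h z hz]
        exact two_le_meromorphicOrderAt_sub hh h2
      by_cases hz' : z + h ∈ L.lattice
      · rw [add_comm]
        refine hz0 _ _ (L.meromorphicOrderAt_weierstrassP_sub_const _ hz') ?_
        rw [← hordper z _ (neg_mem hz'), ← hordper _ _ h2,
          show z + -(z + h) + 2 * h = h by ring]
        exact two_le_meromorphicOrderAt_sub hh h2
      · exact add_nonneg (hnn z hz) (hnn _ hz'))
  refine ⟨c, ?_, hc⟩
  rintro rfl
  -- If the product vanished identically, one factor would have infinite order somewhere.
  have h0 := hord 0
  rw [meromorphicOrderAt_eq_top_iff.mpr (hc 0), eq_comm, WithTop.add_eq_top] at h0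
  rcases h0 with h0 | h0
  · exact L.meromorphicOrderAt_weierstrassP_sub_const_ne_top _ _ h0
  · exact L.meromorphicOrderAt_weierstrassP_sub_const_ne_top _ _ h0

theorem exists_mul_translate_eq (hh : h ∉ L.lattice) (h2 : 2 * h ∈ L.lattice) :
    ∃ c, c ≠ 0 ∧ ∀ z, z ∉ L.lattice → z + h ∉ L.lattice →
      (℘[L] z - ℘[L] h) * (℘[L] (z + h) - ℘[L] h) = c := by
  obtain ⟨c, hc0, hc⟩ := exists_mul_translate_eventuallyEq hh h2
  refine ⟨c, hc0, fun z hz hz' ↦ eq_of_eventuallyEq_const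
    (F := fun z ↦ (℘[L] z - ℘[L] h) * (℘[L] (z + h) - ℘[L] h)) (hc z) ?_⟩
  have h1 := (L.analyticOnNhd_weierstrassP z hz).continuousAt
  have h3 : ContinuousAt (fun z ↦ ℘[L] (z + h)) z :=
    (L.analyticOnNhd_weierstrassP _ hz').continuousAt.comp (f := (· + h)) (by fun_prop)
  fun_prop

theorem add_mem_lattice_of_weierstrassP_eq (hh : h ∉ L.lattice) (h2 : 2 * h ∈ L.lattice) {z : ℂ}
    (hz : z ∉ L.lattice) (he : ℘[L] z = ℘[L] h) : z + h ∈ L.lattice := by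
  obtain ⟨c, hc0, hc⟩ := exists_mul_translate_eq hh h2
  by_contra hz'
  have := hc z hz hz'
  rw [he, sub_self, zero_mul] at this
  exact hc0 this.symm

/-- Comparing orders at `0` in the constant product gives `-2 + n = 0`. -/
theorem analyticOrderAt_sub_eq_two (hh : h ∉ L.lattice) (h2 : 2 * h ∈ L.lattice) :
    analyticOrderAt (fun z ↦ ℘[L] z - ℘[L] h) h = 2 := by
  obtain ⟨c, hc0, hc⟩ := exists_mul_translate_eventuallyEq hh h2
  have ha : AnalyticAt ℂ (fun z ↦ ℘[L] z - ℘[L] h) h :=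
    (L.analyticOnNhd_weierstrassP h hh).sub analyticAt_const
  have h1 := meromorphicOrderAt_congr (hc 0)
  rw [meromorphicOrderAt_const, if_neg hc0] at h1
  have h3 := meromorphicOrderAt_mul (x := (0 : ℂ)) (f := fun z ↦ ℘[L] z - ℘[L] h)
    (g := fun z ↦ ℘[L] (z + h) - ℘[L] h)
    (by have := L.meromorphic_weierstrassP 0; fun_prop)
    ((L.meromorphic_weierstrassP (0 + h)).comp_analyticAt (g := (· + h)) (by fun_prop) |>.sub
      (.const _ _))
  rw [show ((fun z ↦ ℘[L] z - ℘[L] h) * fun z ↦ ℘[L] (z + h) - ℘[L] h) =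
    fun z ↦ (℘[L] z - ℘[L] h) * (℘[L] (z + h) - ℘[L] h) from rfl, h1,
    L.meromorphicOrderAt_weierstrassP_sub_const _ L.lattice.zero_mem,
    meromorphicOrderAt_comp_add_const (fun z ↦ ℘[L] z - ℘[L] h), zero_add,
    ha.meromorphicOrderAt_eq] at h3
  generalize analyticOrderAt (fun z ↦ ℘[L] z - ℘[L] h) h = n at h3
  cases n with
  | top => simp at h3
  | coe n =>
    have h4 : ((0 : ℤ) : WithTop ℤ) = ((-2 + n : ℤ) : WithTop ℤ) := h3
    have h5 := WithTop.coe_injective h4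
    have h6 : n = 2 := by omega
    simp [h6]

end HalfPeriod

/-- `℘` depends only on the lattice. -/
theorem weierstrassP_congr {L M : PeriodPair} (h : L.lattice = M.lattice) : ℘[L] = ℘[M] := by
  funext z
  exact congrArg (fun Λ : Submodule ℤ ℂ ↦ ∑' l : Λ, (1 / (z - (l : ℂ)) ^ 2 - 1 / (l : ℂ) ^ 2)) h

/-! ### The midpoint constants and the cubic. -/

theorem two_mul_halfPeriod_mem (L : PeriodPair) (p : Fin 3) :
    2 * L.halfPeriod p ∈ L.lattice := by
  have h1 := L.ω₁_mem_lattice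
  have h2 := L.ω₂_mem_lattice
  fin_cases p
  · simpa [halfPeriod, mul_div_cancel₀] using h1
  · simpa [halfPeriod, mul_div_cancel₀] using h2
  · convert! neg_mem (add_mem h1 h2) using 1
    simp [halfPeriod]
    ring

theorem half_combination_notMem_lattice (L : PeriodPair) (m n : ℤ) (h : Odd m ∨ Odd n) :
    m / 2 * L.ω₁ + n / 2 * L.ω₂ ∉ L.lattice := by
  rw [mem_lattice]
  rintro ⟨a, b, hab⟩
  have := LinearIndependent.pair_iff.mp L.indep (2 * a - m) (2 * b - n)
    (by simp; linear_combination 2 * hab)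
  simp only [sub_eq_zero] at this
  norm_cast at this
  grind

theorem halfPeriod_notMem_lattice (L : PeriodPair) (p : Fin 3) : L.halfPeriod p ∉ L.lattice := by
  fin_cases p
  · convert! L.half_combination_notMem_lattice 1 0 (by decide) using 2
    simp [halfPeriod]; ring
  · convert! L.half_combination_notMem_lattice 0 1 (by decide) using 2
    simp [halfPeriod]; ring
  · convert! L.half_combination_notMem_lattice (-1) (-1) (by decide) using 2
    simp [halfPeriod]; ring

/-- A coincidence would put the sum of two different half periods in the lattice. -/
theorem midpointConstant_injective (L : PeriodPair) : Function.Injective L.midpointConstant := by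
  intro p q hpq
  by_contra hne
  have h := add_mem_lattice_of_weierstrassP_eq (L.halfPeriod_notMem_lattice q)
    (L.two_mul_halfPeriod_mem q) (L.halfPeriod_notMem_lattice p) hpq
  revert h
  fin_cases p <;> fin_cases q <;> first | exact absurd rfl hne | skip
  · convert! L.half_combination_notMem_lattice 1 1 (by decide) using 2
    simp [halfPeriod]; ring
  · convert! L.half_combination_notMem_lattice 0 (-1) (by decide) using 2
    simp [halfPeriod]; ring
  · convert! L.half_combination_notMem_lattice 1 1 (by decide) using 2
    simp [halfPeriod]; ring
  · convert! L.half_combination_notMem_lattice (-1) 0 (by decide) using 2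
    simp [halfPeriod]; ring
  · convert! L.half_combination_notMem_lattice 0 (-1) (by decide) using 2
    simp [halfPeriod]; ring
  · convert! L.half_combination_notMem_lattice (-1) 0 (by decide) using 2
    simp [halfPeriod]; ring

theorem midpointConstant_cubic (L : PeriodPair) (p : Fin 3) :
    4 * L.midpointConstant p ^ 3 - L.g₂ * L.midpointConstant p - L.g₃ = 0 := by
  rw [midpointConstant, ← L.derivWeierstrassP_sq _ (L.halfPeriod_notMem_lattice p),
    derivWeierstrassP_eq_zero_of_two_mul_mem (L.two_mul_halfPeriod_mem p)]
  simp

/-- Vieta's formula; distinctness of the roots allows the divided differences `e1`, `e2`, `e3`. -/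
theorem four_mul_midpointConstant_mul (L : PeriodPair) :
    4 * (L.midpointConstant 0 * L.midpointConstant 1 * L.midpointConstant 2) = L.g₃ := by
  have h0 := L.midpointConstant_cubic 0
  have h1 := L.midpointConstant_cubic 1
  have h2 := L.midpointConstant_cubic 2
  have h01 : L.midpointConstant 0 - L.midpointConstant 1 ≠ 0 :=
    sub_ne_zero.mpr (L.midpointConstant_injective.ne (by decide))
  have h02 : L.midpointConstant 0 - L.midpointConstant 2 ≠ 0 :=
    sub_ne_zero.mpr (L.midpointConstant_injective.ne (by decide))
  have h12 : L.midpointConstant 1 - L.midpointConstant 2 ≠ 0 :=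
    sub_ne_zero.mpr (L.midpointConstant_injective.ne (by decide))
  generalize L.midpointConstant 0 = x at *
  generalize L.midpointConstant 1 = y at *
  generalize L.midpointConstant 2 = z at *
  have e1 : 4 * (x ^ 2 + x * y + y ^ 2) - L.g₂ = 0 :=
    mul_left_cancel₀ h01 (by linear_combination h0 - h1)
  have e2 : 4 * (x ^ 2 + x * z + z ^ 2) - L.g₂ = 0 :=
    mul_left_cancel₀ h02 (by linear_combination h0 - h2)
  have e3 : x + y + z = 0 := mul_left_cancel₀ h12 (by linear_combination (e1 - e2) / 4)
  linear_combination h0 - x * e1 + 4 * x * y * e3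

/-! ### Zeros of `℘` and the obstruction to a square root. -/

/-- Otherwise `1 / ℘` is constant by Liouville, yet it has order `2` at the origin. -/
theorem exists_weierstrassP_eq_zero (L : PeriodPair) : ∃ z, z ∉ L.lattice ∧ ℘[L] z = 0 := by
  by_contra! hne
  have hnt (z : ℂ) : meromorphicOrderAt ℘[L] z ≤ 0 := by
    by_cases hz : z ∈ L.lattice
    · rw [L.order_weierstrassP z hz]; decide
    · have ha := L.analyticOnNhd_weierstrassP z hz
      rw [ha.meromorphicOrderAt_eq, ha.analyticOrderAt_eq_zero.mpr (hne z hz)]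
      simp
  obtain ⟨c, hc⟩ := L.exists_eventuallyEq_const_of_periodic (F := ℘[L]⁻¹)
    (fun z ↦ (L.meromorphic_weierstrassP z).inv)
    (fun z l hl ↦ by simp [L.weierstrassP_add_of_mem z hl]) (fun z ↦ by
      rw [meromorphicOrderAt_inv]
      specialize hnt z
      generalize meromorphicOrderAt ℘[L] z = n at hnt
      cases n with
      | top => simp
      | coe n =>
        have h1 : n ≤ 0 := WithTop.coe_le_coe.mp hnt
        have h2 : 0 ≤ -n := by omega
        exact WithTop.coe_le_coe.mpr h2)
  have h1 := meromorphicOrderAt_congr (hc 0)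
  classical
  rw [meromorphicOrderAt_inv, L.order_weierstrassP 0 L.lattice.zero_mem,
    meromorphicOrderAt_const] at h1
  split_ifs at h1 <;> exact absurd h1 (by decide)

theorem analyticOrderAt_weierstrassP_eq_one {L : PeriodPair} (hg : L.g₃ ≠ 0) {z : ℂ}
    (hz : z ∉ L.lattice) (h0 : ℘[L] z = 0) : analyticOrderAt ℘[L] z = 1 := by
  refine (L.analyticOnNhd_weierstrassP z hz).analyticOrderAt_eq_one_of_zero_deriv_ne_zero h0 ?_
  rw [L.deriv_weierstrassP]
  intro h
  have := L.derivWeierstrassP_sq z hz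
  rw [h, h0] at this
  exact hg (by linear_combination this)

theorem eventuallyEq_nhdsNE_of_codiscrete {f g : ℂ → ℂ} (h : f =ᶠ[codiscrete ℂ] g) (z : ℂ) :
    f =ᶠ[𝓝[≠] z] g := by
  have := mem_codiscrete.mp h z
  rwa [disjoint_principal_right, compl_compl] at this

theorem not_exists_sqrt {L : PeriodPair} (hg : L.g₃ ≠ 0) :
    ¬ ∃ J : ℂ → ℂ, IsMeromorphicSqrt J ℘[L] := by
  rintro ⟨J, hJ, hJ2⟩
  obtain ⟨z, hz, hz0⟩ := L.exists_weierstrassP_eq_zero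
  have h1 := meromorphicOrderAt_congr (eventuallyEq_nhdsNE_of_codiscrete hJ2 z)
  have h2 : meromorphicOrderAt (fun z ↦ J z ^ 2) z =
      meromorphicOrderAt J z + meromorphicOrderAt J z := by
    simp only [sq]
    exact meromorphicOrderAt_mul (hJ z) (hJ z)
  rw [h2, (L.analyticOnNhd_weierstrassP z hz).meromorphicOrderAt_eq,
    analyticOrderAt_weierstrassP_eq_one hg hz hz0] at h1
  generalize meromorphicOrderAt J z = n at h1
  cases n with
  | top => exact absurd h1 (by decide)
  | coe n =>
    have h3 : n + n = 1 := WithTop.coe_injective h1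
    omega

/-! ### Uniqueness of the primitive function. -/

/-- Near `0`, `(J + K) * (J - K) = 0` while `z * (J + K)` tends to `2`. The identity theorem spreads
`J = K`, and normal form makes it pointwise. -/
theorem IsPrimitiveFunction.unique {L : PeriodPair} {p : Fin 3} {J K : ℂ → ℂ}
    (hJ : L.IsPrimitiveFunction p J) (hK : L.IsPrimitiveFunction p K) : J = K := by
  obtain ⟨hJn, ⟨hJm, hJ2⟩, hJt⟩ := hJ
  obtain ⟨hKn, ⟨hKm, hK2⟩, hKt⟩ := hK
  have h0 : ∀ᶠ z in 𝓝[≠] (0 : ℂ), J z - K z = 0 := by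
    have ht : ∀ᶠ z in 𝓝[≠] (0 : ℂ), z * J z + z * K z ≠ 0 :=
      (hJt.add hKt).eventually_ne (by norm_num)
    filter_upwards [ht, eventuallyEq_nhdsNE_of_codiscrete hJ2 0,
      eventuallyEq_nhdsNE_of_codiscrete hK2 0] with z h1 h2 h3
    have h4 : (z * J z + z * K z) * (J z - K z) = 0 := by
      linear_combination z * (h2 - h3)
    exact (mul_eq_zero.mp h4).resolve_left h1
  funext z
  have h1 : ∀ᶠ z in 𝓝[≠] z, J z - K z = 0 := by
    rw [← meromorphicOrderAt_eq_top_iff]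
    by_contra hne
    refine MeromorphicOn.meromorphicOrderAt_ne_top_of_isPreconnected (U := Set.univ) (y := 0)
      (f := fun z ↦ J z - K z) (fun z _ ↦ (hJm z).sub (hKm z)) isPreconnected_univ
      (Set.mem_univ _) (Set.mem_univ _) hne ?_
    exact meromorphicOrderAt_eq_top_iff.mpr h0
  refine Filter.EventuallyEq.eq_of_nhds
    (((hJn (Set.mem_univ z)).eventuallyEq_nhdsNE_iff_eventuallyEq_nhds (hKn (Set.mem_univ z))).mp ?_)
  filter_upwards [h1] with w hw using sub_eq_zero.mp hw

/-! ### Behaviour at the origin and the candidate root. -/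

theorem tendsto_sq_mul_weierstrassP (L : PeriodPair) :
    Tendsto (fun z ↦ z ^ 2 * ℘[L] z) (𝓝[≠] 0) (𝓝 1) := by
  have hc : ContinuousAt ℘[L - (0 : ℂ)] 0 := (L.analyticAt_weierstrassPExcept 0).continuousAt
  have h1 : Tendsto (fun z ↦ z ^ 2 * ℘[L - (0 : ℂ)] z + 1) (𝓝[≠] 0) (𝓝 1) := by
    have : ContinuousAt (fun z ↦ z ^ 2 * ℘[L - (0 : ℂ)] z + 1) 0 := by fun_prop
    simpa [ContinuousAt] using this.tendsto.mono_left nhdsWithin_le_nhds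
  refine h1.congr' ?_
  filter_upwards [self_mem_nhdsWithin] with z hz
  have hz : z ≠ 0 := hz
  rw [← L.weierstrassPExcept_add 0]
  simp
  field_simp

theorem tendsto_pow_three_mul_derivWeierstrassP (L : PeriodPair) :
    Tendsto (fun z ↦ z ^ 3 * ℘'[L] z) (𝓝[≠] 0) (𝓝 (-2)) := by
  have hc : ContinuousAt ℘'[L - (0 : ℂ)] 0 := (L.analyticAt_derivWeierstrassPExcept 0).continuousAt
  have h1 : Tendsto (fun z ↦ z ^ 3 * ℘'[L - (0 : ℂ)] z - 2) (𝓝[≠] 0) (𝓝 (-2)) := by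
    have : ContinuousAt (fun z ↦ z ^ 3 * ℘'[L - (0 : ℂ)] z - 2) 0 := by fun_prop
    simpa [ContinuousAt] using this.tendsto.mono_left nhdsWithin_le_nhds
  refine h1.congr' ?_
  filter_upwards [self_mem_nhdsWithin] with z hz
  have hz : z ≠ 0 := hz
  have e1 := L.derivWeierstrassPExcept_def 0 z
  simp only [Submodule.coe_zero, sub_zero] at e1
  rw [e1]
  field_simp
  ring

theorem tendsto_weierstrassP_sub_weierstrassP (L M : PeriodPair) :
    Tendsto (fun z ↦ ℘[M] z - ℘[L] z) (𝓝[≠] 0) (𝓝 0) := by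
  have hL : ContinuousAt ℘[L - (0 : ℂ)] 0 := (L.analyticAt_weierstrassPExcept 0).continuousAt
  have hM : ContinuousAt ℘[M - (0 : ℂ)] 0 := (M.analyticAt_weierstrassPExcept 0).continuousAt
  have h1 : ContinuousAt (fun z ↦ ℘[M - (0 : ℂ)] z - ℘[L - (0 : ℂ)] z) 0 := by fun_prop
  have h2 := h1.tendsto.mono_left (nhdsWithin_le_nhds (s := {0}ᶜ))
  simp only [weierstrassPExcept_zero, sub_zero] at h2
  refine h2.congr' (.of_forall fun z ↦ ?_)
  have e1 := L.weierstrassPExcept_add 0 z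
  have e2 := M.weierstrassPExcept_add 0 z
  simp only [Submodule.coe_zero] at e1 e2
  simp only [← e1, ← e2]
  ring

/-- The logarithmic derivative of `℘ - ℘ h`, divided by `-2`. -/
noncomputable def halfLogDeriv (M : PeriodPair) (h z : ℂ) : ℂ :=
  -℘'[M] z / (2 * (℘[M] z - ℘[M] h))

section HalfLogDeriv

variable {L M : PeriodPair} {h : ℂ}

theorem halfLogDeriv_add_of_mem {l : ℂ} (hl : l ∈ M.lattice) (z : ℂ) :
    M.halfLogDeriv h (z + l) = M.halfLogDeriv h z := by
  simp [halfLogDeriv, M.weierstrassP_add_of_mem z hl, M.derivWeierstrassP_add_of_mem z hl]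

theorem halfLogDeriv_eq_zero_of_two_mul_mem {z : ℂ} (hz : 2 * z ∈ M.lattice) :
    M.halfLogDeriv h z = 0 := by
  simp [halfLogDeriv, derivWeierstrassP_eq_zero_of_two_mul_mem hz]

theorem meromorphic_halfLogDeriv : Meromorphic (M.halfLogDeriv h) := fun z ↦ by
  have h1 := M.meromorphic_weierstrassP z
  have h2 := M.meromorphic_derivWeierstrassP z
  unfold halfLogDeriv
  fun_prop

theorem tendsto_mul_halfLogDeriv : Tendsto (fun z ↦ z * M.halfLogDeriv h z) (𝓝[≠] 0) (𝓝 1) := by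
  have h1 : Tendsto (fun z : ℂ ↦ z ^ 2 * ℘[M] h) (𝓝[≠] 0) (𝓝 0) := by
    have : ContinuousAt (fun z : ℂ ↦ z ^ 2 * ℘[M] h) 0 := by fun_prop
    simpa using this.tendsto.mono_left nhdsWithin_le_nhds
  have h2 := M.tendsto_pow_three_mul_derivWeierstrassP.neg.div
    ((M.tendsto_sq_mul_weierstrassP.sub h1).const_mul 2) (by norm_num)
  norm_num at h2
  refine h2.congr' ?_
  filter_upwards [self_mem_nhdsWithin] with z hz
  have hz : z ≠ 0 := hz
  simp only [Pi.div_apply, halfLogDeriv]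
  rw [mul_div_assoc' z, ← mul_div_mul_left (z * -℘'[M] z) _ (pow_ne_zero 2 hz)]
  congr 1 <;> ring

/-- The logarithmic derivative of the constant product is zero. -/
theorem halfLogDeriv_add_half (hh : h ∉ M.lattice) (h2 : 2 * h ∈ M.lattice) (z : ℂ) :
    M.halfLogDeriv h (z + h) = -M.halfLogDeriv h z := by
  -- At the poles both sides take the conventional value `0`; the identity must hold there too,
  -- since the Liouville lemma asks for pointwise periodicity.
  by_cases hz : z ∈ M.lattice
  · have h1 : 2 * z ∈ M.lattice := by rw [two_mul]; exact add_mem hz hz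
    rw [halfLogDeriv_eq_zero_of_two_mul_mem h1, halfLogDeriv_eq_zero_of_two_mul_mem, neg_zero]
    rw [mul_add]; exact add_mem h1 h2
  by_cases hz' : z + h ∈ M.lattice
  · have h1 : 2 * (z + h) ∈ M.lattice := by rw [two_mul]; exact add_mem hz' hz'
    rw [halfLogDeriv_eq_zero_of_two_mul_mem h1, halfLogDeriv_eq_zero_of_two_mul_mem, neg_zero]
    simpa [mul_add] using sub_mem h1 h2
  obtain ⟨c, hc0, hc⟩ := exists_mul_translate_eq hh h2
  have hd1 := (M.hasDerivAt_weierstrassP hz).sub_const (℘[M] h)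
  have hd2 := ((M.hasDerivAt_weierstrassP hz').comp_add_const z h).sub_const (℘[M] h)
  have hev : (fun z ↦ (℘[M] z - ℘[M] h) * (℘[M] (z + h) - ℘[M] h)) =ᶠ[𝓝 z] fun _ ↦ c := by
    have o1 : ∀ᶠ w in 𝓝 z, w ∉ M.lattice := M.isClosed_lattice.isOpen_compl.mem_nhds hz
    have o2 : ∀ᶠ w in 𝓝 (z + h), w ∉ M.lattice := M.isClosed_lattice.isOpen_compl.mem_nhds hz'
    have o3 : Tendsto (· + h) (𝓝 z) (𝓝 (z + h)) := Continuous.tendsto (by fun_prop) z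
    filter_upwards [o1, o3.eventually o2] with w hw hw' using hc w hw hw'
  have hd := (hd1.mul hd2).unique ((hasDerivAt_const z c).congr_of_eventuallyEq hev)
  have hcz := hc z hz hz'
  have n1 : ℘[M] z - ℘[M] h ≠ 0 := left_ne_zero_of_mul (hcz ▸ hc0)
  have n2 : ℘[M] (z + h) - ℘[M] h ≠ 0 := right_ne_zero_of_mul (hcz ▸ hc0)
  simp only [halfLogDeriv]
  rw [← neg_div, div_eq_div_iff (by simpa) (by simpa)]
  linear_combination -2 * hd

/-- `℘ h` is a root of the cubic; cancel that factor from `℘'²` and divide with remainder. This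
exhibits the polar part of the square at `0` as that of `℘`. -/
theorem halfLogDeriv_sq {z : ℂ} (hh : h ∉ M.lattice) (h2 : 2 * h ∈ M.lattice)
    (hz : z ∉ M.lattice) (hn : ℘[M] z ≠ ℘[M] h) :
    M.halfLogDeriv h z ^ 2 =
      ℘[M] z + 2 * ℘[M] h + (3 * ℘[M] h ^ 2 - M.g₂ / 4) / (℘[M] z - ℘[M] h) := by
  have h1 := M.derivWeierstrassP_sq h hh
  rw [derivWeierstrassP_eq_zero_of_two_mul_mem h2] at h1
  have hn' := sub_ne_zero.mpr hn
  rw [halfLogDeriv, div_pow, neg_sq, M.derivWeierstrassP_sq z hz]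
  field_simp
  linear_combination -4 * h1

end HalfLogDeriv

/-- The period pair obtained by doubling the second period. -/
noncomputable def doubleSnd (L : PeriodPair) : PeriodPair where
  ω₁ := L.ω₁
  ω₂ := 2 * L.ω₂
  indep := by
    rw [LinearIndependent.pair_iff]
    intro s t hst
    have := LinearIndependent.pair_iff.mp L.indep s (2 * t)
      (by rw [← hst]; simp; ring)
    simpa using this

/-! ### The square root from the doubled lattice. -/

section DoubleSnd

variable (L : PeriodPair)

theorem doubleSnd_lattice_le {z : ℂ} (hz : z ∈ L.doubleSnd.lattice) : z ∈ L.lattice := by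
  obtain ⟨m, n, rfl⟩ := mem_lattice.mp hz
  exact mem_lattice.mpr ⟨m, 2 * n, by simp [doubleSnd]; ring⟩

theorem mem_lattice_iff_doubleSnd {z : ℂ} :
    z ∈ L.lattice ↔ z ∈ L.doubleSnd.lattice ∨ z + L.ω₂ ∈ L.doubleSnd.lattice := by
  constructor
  · intro hz
    obtain ⟨m, n, rfl⟩ := mem_lattice.mp hz
    rcases Int.even_or_odd' n with ⟨k, rfl | rfl⟩
    · exact .inl (mem_lattice.mpr ⟨m, k, by simp [doubleSnd]; ring⟩)
    · exact .inr (mem_lattice.mpr ⟨m, k + 1, by simp [doubleSnd]; ring⟩)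
  · rintro (hz | hz)
    · exact L.doubleSnd_lattice_le hz
    · simpa using sub_mem (L.doubleSnd_lattice_le hz) L.ω₂_mem_lattice

theorem ω₂_notMem_doubleSnd_lattice : L.ω₂ ∉ L.doubleSnd.lattice := by
  have := L.doubleSnd.ω₂_div_two_notMem_lattice
  simpa [doubleSnd] using this

theorem two_mul_ω₂_mem_doubleSnd_lattice : 2 * L.ω₂ ∈ L.doubleSnd.lattice :=
  L.doubleSnd.ω₂_mem_lattice

theorem halfLogDeriv_doubleSnd_sq_sub_weierstrassP_periodic (z l : ℂ) (hl : l ∈ L.lattice) :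
    L.doubleSnd.halfLogDeriv L.ω₂ (z + l) ^ 2 - ℘[L] (z + l) =
      L.doubleSnd.halfLogDeriv L.ω₂ z ^ 2 - ℘[L] z := by
  rw [L.weierstrassP_add_of_mem z hl]
  rcases L.mem_lattice_iff_doubleSnd.mp hl with hl | hl
  · rw [halfLogDeriv_add_of_mem hl]
  · rw [← neg_sq, ← halfLogDeriv_add_half L.ω₂_notMem_doubleSnd_lattice
      L.two_mul_ω₂_mem_doubleSnd_lattice, add_assoc, halfLogDeriv_add_of_mem hl]

theorem weierstrassP_doubleSnd_ne {z : ℂ} (hz : z ∉ L.lattice) :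
    ℘[L.doubleSnd] z ≠ ℘[L.doubleSnd] L.ω₂ := fun he ↦
  hz (L.mem_lattice_iff_doubleSnd.mpr (.inr (add_mem_lattice_of_weierstrassP_eq
    L.ω₂_notMem_doubleSnd_lattice L.two_mul_ω₂_mem_doubleSnd_lattice
    (fun h ↦ hz (L.doubleSnd_lattice_le h)) he)))

theorem tendsto_halfLogDeriv_doubleSnd_sq_sub :
    ∃ c, Tendsto (fun z ↦ L.doubleSnd.halfLogDeriv L.ω₂ z ^ 2 - ℘[L] z) (𝓝[≠] 0) (𝓝 c) := by
  set M := L.doubleSnd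
  have hinv : Tendsto (fun z ↦ (℘[M] z - ℘[M] L.ω₂)⁻¹) (𝓝[≠] 0) (𝓝 0) := by
    refine tendsto_inv₀_cobounded.comp (tendsto_cobounded_of_meromorphicOrderAt_neg ?_)
    rw [M.meromorphicOrderAt_weierstrassP_sub_const _ M.lattice.zero_mem]
    decide
  refine ⟨_, (((tendsto_weierstrassP_sub_weierstrassP L M).add_const (2 * ℘[M] L.ω₂)).add
    (hinv.const_mul (3 * ℘[M] L.ω₂ ^ 2 - M.g₂ / 4))).congr' ?_⟩
  have hz : ∀ᶠ z in 𝓝[≠] (0 : ℂ), z ∉ L.lattice := by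
    filter_upwards [self_mem_nhdsWithin,
      mem_nhdsWithin_of_mem_nhds (L.compl_lattice_sdiff_singleton_mem_nhds 0)] with z hz hz'
    simp_all
  filter_upwards [hz] with z hz
  rw [halfLogDeriv_sq L.ω₂_notMem_doubleSnd_lattice L.two_mul_ω₂_mem_doubleSnd_lattice
    (fun h ↦ hz (L.doubleSnd_lattice_le h)) (L.weierstrassP_doubleSnd_ne hz), div_eq_mul_inv]
  ring

theorem analyticAt_halfLogDeriv_doubleSnd {z : ℂ} (hz : z ∉ L.lattice) :
    AnalyticAt ℂ (L.doubleSnd.halfLogDeriv L.ω₂) z := by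
  have hzM : z ∉ L.doubleSnd.lattice := fun h ↦ hz (L.doubleSnd_lattice_le h)
  have h1 := L.doubleSnd.analyticOnNhd_weierstrassP z hzM
  have h2 := L.doubleSnd.analyticOnNhd_derivWeierstrassP z hzM
  refine h2.neg.div (analyticAt_const.mul (h1.sub analyticAt_const)) ?_
  simpa [sub_eq_zero] using L.weierstrassP_doubleSnd_ne hz

theorem isMeromorphicSqrt_halfLogDeriv_doubleSnd :
    IsMeromorphicSqrt (L.doubleSnd.halfLogDeriv L.ω₂) fun z ↦ ℘[L] z - ℘[L] (L.ω₁ / 2) := by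
  refine ⟨meromorphic_halfLogDeriv, ?_⟩
  set J := L.doubleSnd.halfLogDeriv L.ω₂
  have hJm (z : ℂ) : MeromorphicAt J z := meromorphic_halfLogDeriv z
  have hFm (z : ℂ) : MeromorphicAt (fun z ↦ J z ^ 2 - ℘[L] z) z :=
    ((hJm z).pow 2).sub (L.meromorphic_weierstrassP z)
  have hFa (z : ℂ) (hz : z ∉ L.lattice) : AnalyticAt ℂ (fun z ↦ J z ^ 2 - ℘[L] z) z :=
    ((L.analyticAt_halfLogDeriv_doubleSnd hz).pow 2).sub (L.analyticOnNhd_weierstrassP z hz)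
  have hper := L.halfLogDeriv_doubleSnd_sq_sub_weierstrassP_periodic
  obtain ⟨c, hc⟩ := L.exists_eventuallyEq_const_of_periodic hFm hper (fun z ↦ by
    by_cases hz : z ∈ L.lattice
    · have h1 : (fun w ↦ J (w + -z) ^ 2 - ℘[L] (w + -z)) = fun z ↦ J z ^ 2 - ℘[L] z :=
        funext fun w ↦ hper w (-z) (neg_mem hz)
      rw [← h1, meromorphicOrderAt_comp_add_const (fun z ↦ J z ^ 2 - ℘[L] z), add_neg_cancel]
      exact (tendsto_nhds_iff_meromorphicOrderAt_nonneg (hFm 0)).mp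
        L.tendsto_halfLogDeriv_doubleSnd_sq_sub
    · exact (hFa z hz).meromorphicOrderAt_nonneg)
  -- `ω₁ / 2` is a half period of both lattices, so `J` vanishes there and the constant is `-℘ (ω₁ /
  -- 2)`.
  have hv := eq_of_eventuallyEq_const (hc (L.ω₁ / 2))
    (hFa _ L.ω₁_div_two_notMem_lattice).continuousAt
  have hJ0 : J (L.ω₁ / 2) = 0 := halfLogDeriv_eq_zero_of_two_mul_mem (by
    rw [mul_div_cancel₀ _ two_ne_zero]
    exact L.doubleSnd.ω₁_mem_lattice)
  rw [hJ0] at hv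
  rw [EventuallyEq, Filter.Eventually, mem_codiscrete]
  intro z
  rw [disjoint_principal_right, compl_compl]
  filter_upwards [hc z] with w hw
  linear_combination hw - hv

end DoubleSnd

/-- A change of basis reduces every `p` to the first half period, since `℘` depends only on the
lattice. -/
theorem exists_lattice_eq_halfPeriod (L : PeriodPair) (p : Fin 3) :
    ∃ M : PeriodPair, M.lattice = L.lattice ∧ M.ω₁ / 2 = L.halfPeriod p := by
  have hL := LinearIndependent.pair_iff.mp L.indep
  fin_cases p
  · exact ⟨L, rfl, by simp [halfPeriod]⟩
  · refine ⟨⟨L.ω₂, L.ω₁, ?_⟩, ?_, by simp [halfPeriod]⟩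
    · exact LinearIndependent.pair_iff.mpr fun s t h ↦ (hL t s (by rw [← h, add_comm])).symm
    · simp [lattice, Set.pair_comm]
  · refine ⟨⟨-(L.ω₁ + L.ω₂), L.ω₁, ?_⟩, ?_, by simp [halfPeriod]; ring⟩
    · refine LinearIndependent.pair_iff.mpr fun s t h ↦ ?_
      have := hL (t - s) (-s) (by rw [← h]; simp; ring)
      constructor <;> linarith [this.1, this.2]
    · ext z
      simp only [mem_lattice]
      constructor
      · rintro ⟨m, n, rfl⟩
        exact ⟨n - m, -m, by push_cast; ring⟩
      · rintro ⟨m, n, rfl⟩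
        exact ⟨-n, m - n, by push_cast; ring⟩

theorem exists_isPrimitiveFunction (L : PeriodPair) (p : Fin 3) :
    ∃ J, L.IsPrimitiveFunction p J := by
  obtain ⟨N, hN, hp⟩ := L.exists_lattice_eq_halfPeriod p
  set K := N.doubleSnd.halfLogDeriv N.ω₂
  obtain ⟨hKm, hK2⟩ := N.isMeromorphicSqrt_halfLogDeriv_doubleSnd
  rw [hp, weierstrassP_congr hN] at hK2
  have hKU : MeromorphicOn K Set.univ := fun z _ ↦ hKm z
  refine ⟨toMeromorphicNFOn K Set.univ, meromorphicNFOn_toMeromorphicNFOn _ _, ⟨?_, ?_⟩, ?_⟩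
  · exact fun z ↦ (meromorphicNFOn_toMeromorphicNFOn K Set.univ (Set.mem_univ z)).meromorphicAt
  · filter_upwards [hK2, toMeromorphicNFOn_eqOn_codiscrete hKU] with z h1 h2
    rw [← h2, ← midpointConstant] at *
    exact h1
  · refine (tendsto_mul_halfLogDeriv (M := N.doubleSnd) (h := N.ω₂)).congr' ?_
    filter_upwards [hKU.toMeromorphicNFOn_eq_self_on_nhdsNE (Set.mem_univ 0)] with z hz
    rw [hz]

end PeriodPair

theorem mainTheorem1 (L : PeriodPair) :
    (L.g₃ = 0 →
      (∃! p : Fin 3, L.midpointConstant p = 0) ∧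
      ∀ p : Fin 3, L.midpointConstant p = 0 →
        analyticOrderAt L.weierstrassP (L.halfPeriod p) = 2 ∧
        (∃! J : ℂ → ℂ, L.IsPrimitiveFunction p J) ∧
        (∀ J : ℂ → ℂ, L.IsPrimitiveFunction p J → IsMeromorphicSqrt J L.weierstrassP)) ∧
    (L.g₃ ≠ 0 →
      (∀ p : Fin 3, L.midpointConstant p ≠ 0) ∧
      (∀ z : ℂ, z ∉ L.lattice → L.weierstrassP z = 0 →
        analyticOrderAt L.weierstrassP z = 1) ∧
      ¬ ∃ J : ℂ → ℂ, IsMeromorphicSqrt J L.weierstrassP) ∧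
    ((∃ J : ℂ → ℂ, IsMeromorphicSqrt J L.weierstrassP) ↔ L.g₃ = 0) := by
  have hsq (p : Fin 3) (hp : L.midpointConstant p = 0) (J : ℂ → ℂ)
      (hJ : L.IsPrimitiveFunction p J) : IsMeromorphicSqrt J L.weierstrassP := by
    simpa [hp] using hJ.2.1
  have hex (hg : L.g₃ = 0) : ∃ p, L.midpointConstant p = 0 := by
    have h := L.four_mul_midpointConstant_mul
    rw [hg] at h
    simp only [mul_eq_zero, OfNat.ofNat_ne_zero, false_or] at h
    rcases h with (h | h) | h <;> exact ⟨_, h⟩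
  refine ⟨fun hg ↦ ⟨?_, fun p hp ↦ ⟨?_, ?_, hsq p hp⟩⟩, fun hg ↦ ⟨fun p hp ↦ ?_, ?_, ?_⟩, ?_⟩
  · obtain ⟨p, hp⟩ := hex hg
    exact ⟨p, hp, fun q hq ↦ L.midpointConstant_injective (hq.trans hp.symm)⟩
  · have h := PeriodPair.analyticOrderAt_sub_eq_two
      (L.halfPeriod_notMem_lattice p)
      (L.two_mul_halfPeriod_mem p)
    rw [← PeriodPair.midpointConstant, hp] at h
    simpa using h
  · obtain ⟨J, hJ⟩ := L.exists_isPrimitiveFunction p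
    exact ⟨J, hJ, fun K hK ↦ hK.unique hJ⟩
  · have h := L.midpointConstant_cubic p
    rw [hp] at h
    exact hg (by linear_combination -h)
  · exact fun z hz h0 ↦ PeriodPair.analyticOrderAt_weierstrassP_eq_one hg hz h0
  · exact PeriodPair.not_exists_sqrt hg
  · refine ⟨fun h ↦ ?_, fun hg ↦ ?_⟩
    · by_contra hg
      exact PeriodPair.not_exists_sqrt hg h
    · obtain ⟨p, hp⟩ := hex hg
      obtain ⟨J, hJ⟩ := L.exists_isPrimitiveFunction p
      exact ⟨J, hsq p hp J hJ⟩
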